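/- Let $p$ be an odd prime, let $m \ge 0$, and let $K/\mathbb{Q}$ be a cyclic extension (that is, a finite Galois extension with cyclic Galois group) of degree $p^m$ that is unramified outside $p$, meaning that every nonzero prime ideal of the ring of integers $\mathcal{O}_K$ not lying above $p$ is unramified over $\mathbb{Q}$. Then $K$ is cyclotomic, i.e. contained in (embeds over $\mathbb{Q}$ into) some cyclotomic field $\mathbb{Q}(\zeta_n)$, $n \ge 1$. More precisely, if $K$ is a subfield of a field $\Omega \supseteq \mathbb{Q}$ and $\zeta \in \Omega$ is any primitive $p^{m+1}$-th root of unity, then $K$ is contained in $\mathbb{Q}(\zeta)$ and is the unique subfield of $\mathbb{Q}(\zeta)$ of degree $p^m$ over $\mathbb{Q}$. -/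

import Mathlib

open scoped NumberField IntermediateField

/-- The extension `K / ℚ` is unramified outside `p`: every nonzero prime ideal of the ring of
integers of `K` that does not lie above `p` is unramified over `ℤ`
(there is no condition at the infinite places). -/
def UnramifiedOutside (p : ℕ) (K : Type*) [Field K] : Prop :=
  ∀ (Q : Ideal (𝓞 K)) [Q.IsPrime], Q ≠ ⊥ → (p : 𝓞 K) ∉ Q → Algebra.IsUnramifiedAt ℤ Q

/-- The extension `K / ℚ` is cyclotomic: `K` is contained in (embeds into) some cyclotomic field
`ℚ(ζ_n)`. -/
def IsCyclotomic (K : Type*) [Field K] [Algebra ℚ K] : Prop :=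
  ∃ n : ℕ, 0 < n ∧ Nonempty (K →ₐ[ℚ] CyclotomicField n ℚ)

/-! It suffices that two cyclic extensions of degree p^m unramified outside p coincide inside a
common field (`eq_of_unramifiedOutside`), since ℚ(ζ), cyclic of degree p^m (p - 1), contains one.
Their compositum is an abelian p-extension unramified outside p, of exponent dividing p^m; if its
group is cyclic, its degree is at most p^m and both fields fill it. If not, the group has a quotient
(ℤ/p)^2, so the point is to exclude an elementary abelian L of degree p^2 unramified outside p
(`UnramifiedOutside.false_of_elementary_abelian`).

By Minkowski the fixed field of inertia at p is ℚ, so L is totally ramified at p with residue field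
𝔽_p. Pigeonhole gives ρ ≠ 1 in the second ramification group; any h outside ⟨ρ⟩ gives a subfield S =
L^⟨h⟩ of degree p, moved by ρ. The h-norm sends 1 + π^2 O into 1 + π^(p+1) O. As ϖ = N_h(π) has v(ϖ)
= v(π)^p, ρ moves elements of S by a relative amount strictly below v(ϖ), hence at most v(ϖ)^2. But
v(p) = v(ϖ)^p, so when 1 + ρ + ⋯ + ρ^(p-1) is expanded in powers of ρ - 1, the term p dominates for
odd p, and this trace cannot kill ρx - x ≠ 0, as it must. -/

/-! ### Valuation estimates for automorphisms, traces and norms -/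

section ValuationShift

variable {L Γ₀ : Type*} [Field L] [LinearOrderedCommGroupWithZero Γ₀] (v : Valuation L Γ₀)

theorem Valuation.map_intCast_le_one (n : ℤ) : v (n : L) ≤ 1 := by
  have h : ∀ k : ℕ, v (k : L) ≤ 1 := by
    intro k
    induction k with
    | zero => simp
    | succ k ih =>
      push_cast
      exact v.map_add_le ih (by simp)
  obtain ⟨k, rfl | rfl⟩ := n.eq_nat_or_neg
  · simpa using h k
  · simpa using h k

/-- If `p` has valuation less than `1`, then integers prime to `p` are units. -/
theorem Valuation.map_intCast_eq_one {p : ℕ} (hp : p.Prime) (hpv : v (p : L) < 1) {n : ℤ}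
    (hn : ¬ (p : ℤ) ∣ n) : v (n : L) = 1 := by
  refine le_antisymm (v.map_intCast_le_one n) (not_lt.1 fun hlt => ?_)
  obtain ⟨a, b, hab⟩ := (Nat.prime_iff_prime_int.1 hp).coprime_iff_not_dvd.2 hn
  have : (a : L) * p + b * n = 1 := by exact_mod_cast congrArg (Int.cast : ℤ → L) hab
  have h2 : v (1 : L) < 1 := by
    rw [← this]
    refine v.map_add_lt ?_ ?_
    · rw [map_mul]
      exact (mul_le_of_le_one_left' (v.map_intCast_le_one a)).trans_lt hpv
    · rw [map_mul]
      exact (mul_le_of_le_one_left' (v.map_intCast_le_one b)).trans_lt hlt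
  simp at h2

theorem Valuation.map_coeff_prod_le_one {ι : Type*} (s : Finset ι) (f : ι → Polynomial L)
    (hf : ∀ i ∈ s, ∀ n, v ((f i).coeff n) ≤ 1) (n : ℕ) : v ((∏ i ∈ s, f i).coeff n) ≤ 1 := by
  refine Finset.prod_induction f (fun P => ∀ n, v (P.coeff n) ≤ 1) ?_ ?_ hf n
  · intro P Q hP hQ n
    rw [Polynomial.coeff_mul]
    refine v.map_sum_le fun x _ => ?_
    rw [map_mul]
    exact mul_le_one' (hP _) (hQ _)
  · intro n
    rw [Polynomial.coeff_one]
    split_ifs <;> simp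

variable [Algebra ℚ L]

/-- If `σ` moves `x` and `y` by a relative amount at most `d`, then also `x * y`. -/
theorem Valuation.map_sub_self_mul_le (σ : Gal(L/ℚ)) (hσ : ∀ x, v (σ x) = v x) {d : Γ₀} {x y : L}
    (hx : v (σ x - x) ≤ d * v x) (hy : v (σ y - y) ≤ d * v y) :
    v (σ (x * y) - x * y) ≤ d * v (x * y) := by
  have h : σ (x * y) - x * y = σ x * (σ y - y) + (σ x - x) * y := by rw [map_mul]; ring
  rw [h]
  refine v.map_add_le ?_ ?_
  · rw [map_mul, map_mul, hσ, mul_left_comm]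
    exact mul_le_mul_right hy _
  · rw [map_mul, map_mul, ← mul_assoc]
    exact mul_le_mul_left hx _

theorem Valuation.map_sub_self_inv_le (σ : Gal(L/ℚ)) (hσ : ∀ x, v (σ x) = v x) {d : Γ₀} {x : L}
    (hx : v (σ x - x) ≤ d * v x) : v (σ x⁻¹ - x⁻¹) ≤ d * v x⁻¹ := by
  rcases eq_or_ne x 0 with rfl | h0
  · simp
  have h1 : σ x ≠ 0 := by simpa using h0
  have h : σ x⁻¹ - x⁻¹ = -(σ x - x) * (x⁻¹ * (σ x)⁻¹) := by
    rw [map_inv₀]; field_simp; ring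
  have hv : v x ≠ 0 := by simpa using h0
  rw [h, map_mul, Valuation.map_neg, map_mul, map_inv₀, map_inv₀, hσ]
  calc v (σ x - x) * ((v x)⁻¹ * (v x)⁻¹) ≤ d * v x * ((v x)⁻¹ * (v x)⁻¹) := mul_le_mul_left hx _
    _ = d * (v x)⁻¹ := by
      rw [mul_assoc, ← mul_assoc (v x), mul_inv_cancel₀ hv, one_mul]

theorem Valuation.map_sub_self_zpow_le (σ : Gal(L/ℚ)) (hσ : ∀ x, v (σ x) = v x) {d : Γ₀} {x : L}
    (hx : v (σ x - x) ≤ d * v x) (n : ℤ) : v (σ (x ^ n) - x ^ n) ≤ d * v (x ^ n) := by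
  have key : ∀ k : ℕ, v (σ (x ^ k) - x ^ k) ≤ d * v (x ^ k) := by
    intro k
    induction k with
    | zero => simp
    | succ k ih =>
      rw [pow_succ]
      exact v.map_sub_self_mul_le σ hσ ih hx
  obtain ⟨k, rfl | rfl⟩ := n.eq_nat_or_neg
  · simpa using key k
  · simpa using v.map_sub_self_inv_le σ hσ (key k)

/-- Factors of the numerator and denominator prime to `p` are units, so only the power of `p`
counts. -/
theorem Valuation.exists_map_ratCast_eq_zpow {p : ℕ} (hp : p.Prime) (hpv : v (p : L) < 1)
    {q : ℚ} (hq : q ≠ 0) : ∃ k : ℤ, v (algebraMap ℚ L q) = v (p : L) ^ k := by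
  have : CharZero L := algebraRat.charZero L
  have key : ∀ n : ℤ, n ≠ 0 → ∃ k : ℕ, v (n : L) = v (p : L) ^ k := by
    intro n hn
    obtain ⟨k, m, hm, h⟩ := (Int.finiteMultiplicity_iff (a := (p : ℤ)) (b := n)).2
      ⟨by simpa using hp.ne_one, hn⟩ |>.exists_eq_pow_mul_and_not_dvd |> fun ⟨m, h1, h2⟩ =>
        (⟨_, m, h2, h1⟩ : ∃ k : ℕ, ∃ m : ℤ, ¬ (p : ℤ) ∣ m ∧ n = (p : ℤ) ^ k * m)
    refine ⟨k, ?_⟩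
    rw [h]
    push_cast
    rw [map_mul, map_pow, v.map_intCast_eq_one hp hpv hm, mul_one]
  obtain ⟨a, ha⟩ := key q.num (by simpa using hq)
  obtain ⟨b, hb⟩ := key q.den (by simp)
  have hp0 : v (p : L) ≠ 0 := by simpa using hp.ne_zero
  refine ⟨a - b, ?_⟩
  rw [eq_ratCast, Rat.cast_def, map_div₀, ha, zpow_sub₀ hp0, zpow_natCast, zpow_natCast, ← hb]
  simp

/-- `1 + h + ⋯ + h ^ (p - 1)` expanded in powers of `h - 1`. -/
theorem sum_pow_eq_sum_choose {R : Type*} [Ring R] (T : R) (n : ℕ) :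
    ∑ j ∈ Finset.range n, T ^ j = ∑ k ∈ Finset.range n, (n.choose (k + 1) : R) * (T - 1) ^ k := by
  have h := congrArg (Polynomial.aeval (R := ℤ) (T - 1))
    (Polynomial.geom_sum_X_comp_X_add_one_eq_sum (R := ℤ) n)
  rw [Polynomial.aeval_comp] at h
  simpa using h

theorem sum_pow_apply_eq_sum_choose (h : Gal(L/ℚ)) (n : ℕ) (z : L) :
    ∑ j ∈ Finset.range n, (h ^ j) z =
      ∑ k ∈ Finset.range n, (n.choose (k + 1) : L) *
        (((h : L →ₗ[ℚ] L) - 1 : Module.End ℚ L) ^ k) z := by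
  have e := LinearMap.congr_fun (sum_pow_eq_sum_choose (R := Module.End ℚ L) (h : L →ₗ[ℚ] L) n) z
  have hp : ∀ j : ℕ, ((h : L →ₗ[ℚ] L) ^ j : Module.End ℚ L) z = (h ^ j) z := by
    intro j
    induction j with
    | zero => simp
    | succ j ih =>
      rw [pow_succ', pow_succ', Module.End.mul_apply, ih]
      rfl
  simpa [LinearMap.sum_apply, hp, ← nsmul_eq_mul] using e

theorem Valuation.map_sub_one_pow_le (h : Gal(L/ℚ)) {c : Γ₀} (hh : ∀ x, v (h x - x) ≤ c * v x)
    (k : ℕ) (z : L) : v ((((h : L →ₗ[ℚ] L) - 1 : Module.End ℚ L) ^ k) z) ≤ c ^ k * v z := by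
  induction k with
  | zero => simp
  | succ k ih =>
    rw [pow_succ', Module.End.mul_apply, pow_succ', mul_assoc]
    exact (hh _).trans (mul_le_mul_right ih c)

/-- In the expansion in powers of `h - 1`, only the last term `(h - 1) ^ (p - 1)` has a coefficient
prime to `p`; the other coefficients are divisible by `p`, whose value is at most `c ^ (p - 1)`. -/
theorem Valuation.map_sum_pow_le {p : ℕ} (hp : p.Prime) (h : Gal(L/ℚ)) {c : Γ₀} (hc : c ≤ 1)
    (hh : ∀ x, v (h x - x) ≤ c * v x) (hpc : v (p : L) ≤ c ^ (p - 1)) (z : L) :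
    v (∑ j ∈ Finset.range p, (h ^ j) z) ≤ c ^ (p - 1) * v z := by
  rw [sum_pow_apply_eq_sum_choose]
  refine v.map_sum_le fun k hk => ?_
  rw [Finset.mem_range] at hk
  rw [map_mul]
  have h1 := v.map_sub_one_pow_le h hh k z
  rcases (show k + 1 ≤ p from hk).eq_or_lt with hk' | hk'
  · rw [hk', Nat.choose_self, Nat.cast_one, map_one, one_mul]
    rwa [show p - 1 = k by omega]
  · obtain ⟨m, hm⟩ := hp.dvd_choose_self k.succ_ne_zero hk'
    refine mul_le_mul' ?_ (h1.trans (mul_le_of_le_one_left' (pow_le_one' hc k)))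
    rw [hm, Nat.cast_mul, map_mul]
    refine (mul_le_of_le_one_right' ?_).trans hpc
    simpa using v.map_intCast_le_one (m : ℤ)

theorem map_prod_range_pow_apply (h : Gal(L/ℚ)) {p : ℕ} (hord : h ^ p = 1) (ε : L) (j : ℕ) :
    (∏ i ∈ Finset.range p, (1 + Polynomial.C ((h ^ i) ε) * Polynomial.X)).map
        ((h ^ j : Gal(L/ℚ)) : L →+* L) =
      ∏ i ∈ Finset.range p, (1 + Polynomial.C ((h ^ i) ε) * Polynomial.X) := by
  have h1 : (∏ i ∈ Finset.range p, (1 + Polynomial.C ((h ^ i) ε) * Polynomial.X)).map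
        ((h : Gal(L/ℚ)) : L →+* L) =
      ∏ i ∈ Finset.range p, (1 + Polynomial.C ((h ^ i) ε) * Polynomial.X) := by
    have e : ∀ i, h ((h ^ i) ε) = (h ^ (i + 1)) ε := fun i => by rw [pow_succ']; rfl
    -- Two ways to split a product of `p + 1` factors; as `h ^ p = 1`, the split-off factors agree
    -- and cancel, giving invariance under the cyclic shift.
    have e2 := (Finset.prod_range_succ (fun i => 1 + Polynomial.C ((h ^ i) ε) * Polynomial.X) p).symm.trans
      (Finset.prod_range_succ' (fun i => 1 + Polynomial.C ((h ^ i) ε) * Polynomial.X) p)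
    rw [hord, pow_zero] at e2
    have h0 : (1 + Polynomial.C ((1 : Gal(L/ℚ)) ε) * Polynomial.X) ≠ 0 := fun h0 => by
      simpa using congrArg (Polynomial.eval 0) h0
    simpa [Polynomial.map_prod, e, -AlgEquiv.coe_pow] using (mul_right_cancel₀ h0 e2).symm
  induction j with
  | zero =>
    convert! Polynomial.map_id
  | succ j ih =>
    have : ((h ^ (j + 1) : Gal(L/ℚ)) : L →+* L) =
      ((h ^ j : Gal(L/ℚ)) : L →+* L).comp ((h : Gal(L/ℚ)) : L →+* L) := by
      rw [pow_succ]; rfl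
    rw [this, ← Polynomial.map_map, h1, ih]

/-- The norm of a unit close to `1`: if `h` has order `p` and moves everything by a relative amount
at most `c`, then `∏ h ^ j (1 + ε)` is close to `1` for small `ε`. -/
theorem Valuation.map_prod_pow_sub_one_le {p : ℕ} (hp : p.Prime) (h : Gal(L/ℚ)) {c : Γ₀}
    (hc : c < 1) (hinv : ∀ x, v (h x) = v x)
    (hh : ∀ x, v (h x - x) ≤ c * v x) (hpc : v (p : L) ≤ c ^ (p - 1)) (hpv : v (p : L) < 1)
    (hord : h ^ p = 1) {ε : L} (hε : v ε ≤ c ^ 2) :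
    v (∏ j ∈ Finset.range p, (h ^ j) (1 + ε) - 1) ≤ c ^ (p + 1) := by
  classical
  have hinvp : ∀ (j : ℕ) x, v ((h ^ j) x) = v x := by
    intro j
    induction j with
    | zero => simp
    | succ j ih =>
      intro x
      rw [pow_succ', AlgEquiv.mul_apply, hinv, ih]
  have hc1 := hc.le
  -- The norm is the value at 1 of `∏ (1 + h^i(ε) X)`, whose coefficients are bounded one by one.
  set f : ℕ → Polynomial L := fun i => 1 + Polynomial.C ((h ^ i) ε) * Polynomial.X with hf
  have hε1 : v ε ≤ 1 := hε.trans (pow_le_one' hc1 2)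
  have hfc : ∀ i n, v ((f i).coeff n) ≤ 1 := by
    intro i n
    simp only [hf, Polynomial.coeff_add, Polynomial.coeff_one, Polynomial.coeff_C_mul,
      Polynomial.coeff_X]
    refine v.map_add_le ?_ ?_
    · split_ifs <;> simp
    · split_ifs <;> simp [hinvp, hε1, -AlgEquiv.coe_pow]
  have hfd : ∀ i, (f i).natDegree ≤ 1 := by
    intro i
    simp only [hf]
    compute_degree
  set F : Polynomial L := ∏ i ∈ Finset.range p, f i with hF
  set G : ℕ → Polynomial L := fun j => ∏ i ∈ (Finset.range p).erase j, f i with hG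
  have hfG : ∀ j ∈ Finset.range p, G j * f j = F := fun j hj => Finset.prod_erase_mul _ _ hj
  have hf0 : ∀ i, f i ≠ 0 := fun i h0 => by
    simpa [hf] using congrArg (Polynomial.eval 0) h0
  have hGmap : ∀ j ∈ Finset.range p, G j = (G 0).map ((h ^ j : Gal(L/ℚ)) : L →+* L) := by
    intro j hj
    refine mul_right_cancel₀ (hf0 j) ?_
    have e : f j = (f 0).map ((h ^ j : Gal(L/ℚ)) : L →+* L) := by simp [hf]
    rw [hfG j hj]
    nth_rw 1 [e]
    rw [← Polynomial.map_mul, hfG 0 (Finset.mem_range.2 hp.pos), hF,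
      map_prod_range_pow_apply h hord]
  -- By the product rule, the coefficients of the derivative are traces under `h`. The trace gains
  -- `c ^ (p - 1)` and the factor `ε` gains `c ^ 2`.
  have hder : ∀ n, (Polynomial.derivative F).coeff n =
      ∑ j ∈ Finset.range p, (h ^ j) (ε * (G 0).coeff n) := by
    intro n
    rw [hF, Polynomial.derivative_prod_finset, Polynomial.finsetSum_coeff]
    refine Finset.sum_congr rfl fun j hj => ?_
    have e : Polynomial.derivative (f j) = Polynomial.C ((h ^ j) ε) := by simp [hf]
    rw [e, Polynomial.coeff_mul_C, map_mul, mul_comm]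
    congr 1
    exact (congrArg (fun P => P.coeff n) (hGmap j hj)).trans (Polynomial.coeff_map _ _)
  have hdb : ∀ n, v ((Polynomial.derivative F).coeff n) ≤ c ^ (p + 1) := by
    intro n
    rw [hder]
    refine (v.map_sum_pow_le hp h hc1 hh hpc _).trans ?_
    rw [map_mul, show p + 1 = (p - 1) + 2 by have := hp.pos; omega, pow_add]
    exact mul_le_mul_right ((mul_le_of_le_one_right'
      (v.map_coeff_prod_le_one _ _ (fun i _ => hfc i) n)).trans hε) _
  have heval : ∏ j ∈ Finset.range p, (h ^ j) (1 + ε) = F.eval 1 := by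
    simp [hF, hf, Polynomial.eval_prod]
  have hdeg : F.natDegree < p + 1 := by
    refine Nat.lt_succ_of_le ((Polynomial.natDegree_prod_le _ _).trans ?_)
    exact (Finset.sum_le_card_nsmul _ _ 1 fun i _ => hfd i).trans (by simp)
  have hF0 : F.coeff 0 = 1 := by
    rw [Polynomial.coeff_zero_eq_eval_zero]
    simp [hF, hf, Polynomial.eval_prod]
  rw [heval, Polynomial.eval_eq_sum_range' hdeg, Finset.sum_range_succ', hF0]
  simp only [one_pow, mul_one, add_sub_cancel_right]
  refine v.map_sum_le fun k hk => ?_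
  rw [Finset.mem_range] at hk
  -- The derivative controls the coefficient of index `k + 1` only if `k + 1` is a unit; the top one
  -- is instead the norm of `ε`.
  rcases (show k + 1 ≤ p from hk).eq_or_lt with hk' | hk'
  · have e : F.coeff p = ∏ i ∈ Finset.range p, (h ^ i) ε := by
      have := Polynomial.coeff_prod_of_natDegree_le (Finset.range p) f 1 fun i _ => hfd i
      simpa [hF, hf, Polynomial.coeff_one, -AlgEquiv.coe_pow] using this
    rw [hk', e, map_prod]
    simp only [hinvp, Finset.prod_const, Finset.card_range]
    calc v ε ^ p ≤ (c ^ 2) ^ p := pow_le_pow_left' hε p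
      _ = c ^ (2 * p) := (pow_mul _ _ _).symm
      _ ≤ c ^ (p + 1) := pow_le_pow_right_of_le_one' hc1 (by have := hp.two_le; omega)
  · have h1 := hdb k
    rw [Polynomial.coeff_derivative, map_mul] at h1
    have h2 : v ((k : L) + 1) = 1 := by
      have := v.map_intCast_eq_one hp hpv (n := (k + 1 : ℕ))
        (by exact_mod_cast Nat.not_dvd_of_pos_of_lt k.succ_pos hk')
      simpa using this
    rwa [h2, mul_one] at h1

end ValuationShift

/-! ### Ramification filtration of a totally ramified valuation -/

section TotallyRamified

variable {L Γ₀ : Type*} [Field L] [LinearOrderedCommGroupWithZero Γ₀]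

theorem Valuation.map_prod_sub_pow_lt_one (v : Valuation L Γ₀) {a : ℕ → L} {n : ℤ}
    (ha : ∀ j, v (a j - n) < 1) (k : ℕ) : v (∏ j ∈ Finset.range k, a j - (n : L) ^ k) < 1 := by
  induction k with
  | zero => simp
  | succ k ih =>
    have h : ∏ j ∈ Finset.range (k + 1), a j - (n : L) ^ (k + 1) =
        (∏ j ∈ Finset.range k, a j - (n : L) ^ k) * a k + (n : L) ^ k * (a k - n) := by
      rw [Finset.prod_range_succ]; ring
    have hak : v (a k) ≤ 1 := by
      have := v.map_add_le (ha k).le (v.map_intCast_le_one n)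
      simpa using this
    rw [h]
    refine v.map_add_lt ?_ ?_
    · rw [map_mul]
      exact (mul_le_of_le_one_right' hak).trans_lt ih
    · rw [map_mul, map_pow]
      exact (mul_le_of_le_one_left' (pow_le_one' (v.map_intCast_le_one n) k)).trans_lt (ha k)

variable [Algebra ℚ L]

/-- `v` is a Galois-invariant discrete valuation with uniformizer `π`, residue field `𝔽_p` and
absolute ramification index `e`. -/
structure Valuation.IsTotallyRamified (v : Valuation L Γ₀) (p e : ℕ) (π : L) : Prop where
  prime : p.Prime
  e_ne_zero : e ≠ 0
  ne_zero : π ≠ 0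
  lt_one : v π < 1
  exists_zpow : ∀ x, x ≠ 0 → ∃ n : ℤ, v x = v π ^ n
  exists_intCast : ∀ x, v x ≤ 1 → ∃ n : ℤ, v (x - n) < 1
  map_prime : v (p : L) = v π ^ e
  map_gal : ∀ (σ : Gal(L/ℚ)) x, v (σ x) = v x

namespace Valuation.IsTotallyRamified

variable {v : Valuation L Γ₀} {p e : ℕ} {π : L}

theorem map_prime_lt_one (H : v.IsTotallyRamified p e π) : v (p : L) < 1 := by
  rw [H.map_prime]
  exact pow_lt_one' H.lt_one H.e_ne_zero

theorem pos (H : v.IsTotallyRamified p e π) : 0 < v π := by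
  simpa [zero_lt_iff] using H.ne_zero

theorem le_of_lt_one (H : v.IsTotallyRamified p e π) {x : L} (hx : v x < 1) : v x ≤ v π := by
  rcases eq_or_ne x 0 with rfl | h0
  · simp
  obtain ⟨n, hn⟩ := H.exists_zpow x h0
  rw [hn] at hx ⊢
  have h1 : (0 : ℤ) < n := by
    by_contra hcon
    exact absurd hx (not_lt.2 (one_le_zpow_of_nonpos₀ H.pos H.lt_one.le (not_lt.1 hcon)))
  calc v π ^ n ≤ v π ^ (1 : ℤ) := zpow_le_zpow_right_of_le_one₀ H.pos H.lt_one.le h1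
    _ = v π := zpow_one _

/-- Automorphisms of order `p` are wild. -/
theorem map_sub_self_le (H : v.IsTotallyRamified p e π) {σ : Gal(L/ℚ)} (hσ : σ ^ p = 1) (x : L) :
    v (σ x - x) ≤ v π * v x := by
  rcases eq_or_ne x 0 with rfl | h0
  · simp
  have hv0 : v x ≠ 0 := by simpa using h0
  have ht : v (σ x / x) = 1 := by rw [map_div₀, H.map_gal, div_self hv0]
  obtain ⟨n, hn⟩ := H.exists_intCast _ ht.le
  have hj : ∀ j : ℕ, v ((σ ^ j) (σ x / x) - n) < 1 := by
    intro j
    have := H.map_gal (σ ^ j) (σ x / x - n)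
    rw [_root_.map_sub, map_intCast] at this
    rwa [this]
  -- All conjugates of `σ x / x` lie in the residue class of `n`, and their product telescopes to 1.
  -- So `n ^ p ≡ 1`, and Fermat's `n ^ p ≡ n` gives `n ≡ 1`.
  have hprod : ∏ j ∈ Finset.range p, (σ ^ j) (σ x / x) = 1 := by
    have h1 : ∀ j : ℕ, (σ ^ j) (σ x / x) = (σ ^ (j + 1)) x / (σ ^ j) x := by
      intro j
      rw [map_div₀, pow_succ, AlgEquiv.mul_apply]
    simp_rw [h1]
    have h2 : ∀ k : ℕ, ∏ j ∈ Finset.range k, (σ ^ (j + 1)) x / (σ ^ j) x = (σ ^ k) x / x := by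
      intro k
      induction k with
      | zero => simp [h0]
      | succ k ih =>
        have : (σ ^ k) x ≠ 0 := by simpa [-AlgEquiv.coe_pow] using h0
        rw [Finset.prod_range_succ, ih]
        field_simp
    rw [h2, hσ, AlgEquiv.one_apply, div_self h0]
  have h1 := v.map_prod_sub_pow_lt_one hj p
  rw [hprod] at h1
  have h2 : v ((n : L) ^ p - n) < 1 := by
    have : Fact p.Prime := ⟨H.prime⟩
    have hd : (p : ℤ) ∣ n ^ p - n := by
      rw [← ZMod.intCast_zmod_eq_zero_iff_dvd]
      simp
    obtain ⟨m, hm⟩ := hd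
    have e1 : (n : L) ^ p - n = p * m := by exact_mod_cast congrArg (Int.cast : ℤ → L) hm
    rw [e1, map_mul]
    exact (mul_le_of_le_one_right' (v.map_intCast_le_one m)).trans_lt H.map_prime_lt_one
  have h3 : v (σ x / x - 1) < 1 := by
    have e1 : σ x / x - 1 = (σ x / x - n) - (1 - (n : L) ^ p) - ((n : L) ^ p - n) := by ring
    rw [e1]
    exact v.map_sub_lt (v.map_sub_lt hn h1) h2
  have h4 : σ x - x = (σ x / x - 1) * x := by field_simp
  rw [h4, map_mul]
  exact mul_le_mul_left (H.le_of_lt_one h3) _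

/-- To bound how far `ρ` moves the elements of a subfield, it suffices to look at a uniformizer. -/
theorem map_sub_self_le_of_uniformizer (H : v.IsTotallyRamified p e π)
    (S : IntermediateField ℚ L) {ϖ : L} (hϖS : ϖ ∈ S) (hϖ : v ϖ < 1) (hϖ0 : ϖ ≠ 0)
    (hS : ∀ x ∈ S, x ≠ 0 → ∃ n : ℤ, v x = v ϖ ^ n) {ρ : Gal(L/ℚ)} {d : Γ₀}
    (hw : ∀ x ∈ S, v (ρ x - x) ≤ d * v x) (hρ : v (ρ ϖ - ϖ) ≤ d * v ϖ * v ϖ) {x : L}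
    (hx : x ∈ S) : v (ρ x - x) ≤ d * v ϖ * v x := by
  rcases eq_or_ne x 0 with rfl | h0
  · simp
  have hpos : 0 < v ϖ := by simpa [zero_lt_iff] using hϖ0
  obtain ⟨n, hn⟩ := hS x hx h0
  -- The unit part of `x` differs from an integer `a` by at most `v ϖ`. Since `ρ` fixes `a`, it
  -- moves the unit part only as much as this difference.
  have hu : v (x / ϖ ^ n) = 1 := by
    rw [map_div₀, map_zpow₀, hn, div_self (zpow_ne_zero _ hpos.ne')]
  obtain ⟨a, ha⟩ := H.exists_intCast _ hu.le
  have hwS : x / ϖ ^ n - a ∈ S := sub_mem (div_mem hx (zpow_mem hϖS n)) (intCast_mem S a)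
  have hle : v (x / ϖ ^ n - a) ≤ v ϖ := by
    rcases eq_or_ne (x / ϖ ^ n - a) 0 with h | h
    · simp [h]
    obtain ⟨m, hm⟩ := hS _ hwS h
    rw [hm] at ha ⊢
    have h1 : (0 : ℤ) < m := by
      by_contra hcon
      exact absurd ha (not_lt.2 (one_le_zpow_of_nonpos₀ hpos hϖ.le (not_lt.1 hcon)))
    calc v ϖ ^ m ≤ v ϖ ^ (1 : ℤ) := zpow_le_zpow_right_of_le_one₀ hpos hϖ.le h1
      _ = v ϖ := zpow_one _
  have h2 : v (ρ (x / ϖ ^ n) - x / ϖ ^ n) ≤ d * v ϖ * v (x / ϖ ^ n) := by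
    rw [hu, mul_one]
    have := hw _ hwS
    rw [_root_.map_sub ρ, map_intCast, sub_sub_sub_cancel_right] at this
    exact this.trans (mul_le_mul_right hle d)
  have h3 := v.map_sub_self_mul_le ρ (H.map_gal ρ)
    (v.map_sub_self_zpow_le ρ (H.map_gal ρ) hρ n) h2
  rwa [mul_div_cancel₀ x (zpow_ne_zero n hϖ0)] at h3

/-- The second ramification group has index at most `p`. -/
theorem exists_ne_one_map_sub_self_le (H : v.IsTotallyRamified p e π) [Finite Gal(L/ℚ)]
    (hexp : ∀ σ : Gal(L/ℚ), σ ^ p = 1) (hcard : p < Nat.card Gal(L/ℚ)) :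
    ∃ ρ : Gal(L/ℚ), ρ ≠ 1 ∧ ∀ x, v (ρ x - x) ≤ v π ^ 2 * v x := by
  have hπ2 : v π ^ 2 ≠ 0 := pow_ne_zero _ H.pos.ne'
  -- The quotient `(σ π - π) / π ^ 2` has one of `p` residues, so two of the more than `p`
  -- automorphisms share a residue; their quotient is `ρ`.
  have h1 : ∀ σ : Gal(L/ℚ), ∃ n : ℤ, v ((σ π - π) / π ^ 2 - n) < 1 := by
    intro σ
    refine H.exists_intCast _ ?_
    rw [map_div₀, map_pow]
    refine div_le_one_of_le₀ ?_ zero_le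
    rw [pow_two]
    exact H.map_sub_self_le (hexp σ) π
  choose n hn using h1
  have : NeZero p := ⟨H.prime.ne_zero⟩
  obtain ⟨σ, τ, hne, heq⟩ : ∃ σ τ : Gal(L/ℚ), σ ≠ τ ∧ (n σ : ZMod p) = n τ := by
    by_contra! hcon
    have hinj : Function.Injective fun σ : Gal(L/ℚ) => (n σ : ZMod p) := fun σ τ h => by
      by_contra hne
      exact hcon σ τ hne h
    have := Nat.card_le_card_of_injective _ hinj
    rw [Nat.card_zmod] at this
    omega
  have hnn : v ((n σ : L) - n τ) < 1 := by
    obtain ⟨m, hm⟩ := (ZMod.intCast_eq_intCast_iff_dvd_sub _ _ _).1 heq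
    have e1 : (n σ : L) - n τ = -(p * m) := by
      rw [← neg_sub, neg_inj]
      exact_mod_cast congrArg (Int.cast : ℤ → L) hm
    rw [e1, Valuation.map_neg, map_mul]
    exact (mul_le_of_le_one_right' (v.map_intCast_le_one m)).trans_lt H.map_prime_lt_one
  have hdiff : v ((σ π - τ π) / π ^ 2) < 1 := by
    have e1 : (σ π - τ π) / π ^ 2 = ((σ π - π) / π ^ 2 - n σ) - ((τ π - π) / π ^ 2 - n τ) +
        ((n σ : L) - n τ) := by ring
    rw [e1]
    exact v.map_add_lt (v.map_sub_lt (hn σ) (hn τ)) hnn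
  have hdiff' : v (σ π - τ π) ≤ v π * v π * v π := by
    have e1 : σ π - τ π = (σ π - τ π) / π ^ 2 * π ^ 2 := by
      have := H.ne_zero
      field_simp
    rw [e1, map_mul, map_pow, mul_assoc, ← pow_two]
    exact mul_le_mul_left (H.le_of_lt_one hdiff) _
  refine ⟨τ⁻¹ * σ, fun h => hne (inv_mul_eq_one.1 h).symm, fun x => ?_⟩
  rw [pow_two]
  refine H.map_sub_self_le_of_uniformizer ⊤ (IntermediateField.mem_top) H.lt_one H.ne_zero
    (fun x _ => H.exists_zpow x) (fun x _ => H.map_sub_self_le (hexp _) x) ?_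
    IntermediateField.mem_top
  have e1 : (τ⁻¹ * σ) π - π = τ⁻¹ (σ π - τ π) := by
    rw [_root_.map_sub, AlgEquiv.mul_apply, ← AlgEquiv.mul_apply τ⁻¹ τ, inv_mul_cancel, AlgEquiv.one_apply]
  rwa [e1, H.map_gal]

end Valuation.IsTotallyRamified

end TotallyRamified

/-! ### Excluding elementary abelian groups of order p^2: the local argument -/

section NoElementaryAbelian

theorem Subgroup.eq_top_of_card_eq_prime_sq {G : Type*} [Group G] {p : ℕ} (hp : p.Prime)
    (hcard : Nat.card G = p ^ 2) {M N : Subgroup G} (hN : Nat.card N = p) (h : N < M) : M = ⊤ := by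
  have : Finite G := Nat.finite_of_card_ne_zero (by rw [hcard]; exact pow_ne_zero _ hp.ne_zero)
  have h1 : Nat.card M ∣ p ^ 2 := hcard ▸ M.card_subgroup_dvd_card
  obtain ⟨k, hk, hM⟩ := (Nat.dvd_prime_pow hp).1 h1
  have h2 : p < Nat.card M := by
    rw [← hN]
    exact Set.ncard_lt_ncard (SetLike.coe_strictMono h) (Set.toFinite _)
  have h3 : k = 2 := by
    interval_cases k
    · have := hp.pos
      rw [pow_zero] at hM
      omega
    · rw [pow_one] at hM
      omega
    · rfl
  exact Subgroup.eq_top_of_card_eq _ (by rw [hM, hcard, h3])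

theorem card_zpowers_eq_prime {G : Type*} [Group G] {p : ℕ} (hp : p.Prime) {g : G} (hg : g ≠ 1)
    (hgp : g ^ p = 1) : Nat.card (Subgroup.zpowers g) = p := by
  rw [Nat.card_zpowers]
  exact orderOf_eq_prime (hp := ⟨hp⟩) hgp hg

variable {L Γ₀ : Type*} [Field L] [Algebra ℚ L] [LinearOrderedCommGroupWithZero Γ₀]
  {v : Valuation L Γ₀} {p : ℕ} {π : L}

namespace Valuation.IsTotallyRamified

/-- Valuations on the fixed field of a subgroup of order `p`. -/
theorem exists_zpow_of_mem_fixedField (H : v.IsTotallyRamified p (p ^ 2) π) [FiniteDimensional ℚ L]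
    [IsGalois ℚ L] (hcomm : ∀ σ τ : Gal(L/ℚ), σ * τ = τ * σ) (hexp : ∀ σ : Gal(L/ℚ), σ ^ p = 1)
    (hcard : Nat.card Gal(L/ℚ) = p ^ 2) {h ρ : Gal(L/ℚ)} (h1 : h ≠ 1)
    (hρ : ρ ∉ Subgroup.zpowers h) {x : L}
    (hx : x ∈ IntermediateField.fixedField (Subgroup.zpowers h)) (hx0 : x ≠ 0) :
    ∃ n : ℤ, v x = (v π ^ p) ^ n := by
  have hhx : h x = x := hx ⟨h, Subgroup.mem_zpowers h⟩
  -- Fixed by both `h` and `ρ`, which generate the group, `y` is rational. So `v x ^ p = v y` is a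
  -- power of `v p = v π ^ (p ^ 2)`.
  set y := ∏ j ∈ Finset.range p, (ρ ^ j) x with hy
  have hhy : h y = y := by
    rw [hy, map_prod]
    refine Finset.prod_congr rfl fun j _ => ?_
    rw [← AlgEquiv.mul_apply, hcomm, AlgEquiv.mul_apply, hhx]
  have hρy : ρ y = y := by
    have e : ∀ i, ρ ((ρ ^ i) x) = (ρ ^ (i + 1)) x := fun i => by rw [pow_succ']; rfl
    have e2 := (Finset.prod_range_succ (fun i => (ρ ^ i) x) p).symm.trans
      (Finset.prod_range_succ' (fun i => (ρ ^ i) x) p)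
    rw [hexp ρ, pow_zero] at e2
    rw [hy, map_prod]
    simp_rw [e]
    exact (mul_right_cancel₀ (by simpa using hx0) e2).symm
  have htop : MulAction.stabilizer Gal(L/ℚ) y = ⊤ := by
    refine Subgroup.eq_top_of_card_eq_prime_sq H.prime hcard
      (card_zpowers_eq_prime H.prime h1 (hexp h)) (lt_of_le_of_ne ?_ fun heq => hρ ?_)
    · rw [Subgroup.zpowers_le]
      exact hhy
    · rw [heq]
      exact hρy
  obtain ⟨q, hq⟩ := (IsGalois.mem_bot_iff_fixed (F := ℚ) y).2 fun σ => by
    have : σ ∈ MulAction.stabilizer Gal(L/ℚ) y := htop ▸ Subgroup.mem_top σ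
    exact this
  have hvy : v y = v x ^ p := by
    rw [hy, map_prod]
    simp [H.map_gal, -AlgEquiv.coe_pow]
  have hq0 : q ≠ 0 := by
    rintro rfl
    have h0 : y = 0 := by rw [← hq]; simp
    rw [h0, map_zero] at hvy
    exact hx0 (v.zero_iff.1 (pow_eq_zero_iff H.prime.ne_zero |>.1 hvy.symm))
  obtain ⟨k, hk⟩ := v.exists_map_ratCast_eq_zpow H.prime H.map_prime_lt_one hq0
  obtain ⟨n, hn⟩ := H.exists_zpow x hx0
  refine ⟨k, ?_⟩
  have e1 : v π ^ (n * p) = v π ^ ((p : ℤ) ^ 2 * k) := by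
    rw [zpow_mul, zpow_mul, ← hn, zpow_natCast, ← hvy, ← hq]
    refine hk.trans ?_
    rw [H.map_prime]
    congr 1
    exact_mod_cast (zpow_natCast (v π) (p ^ 2)).symm
  have e2 := zpow_right_injective₀ H.pos H.lt_one.ne e1
  have hp0 : (p : ℤ) ≠ 0 := by exact_mod_cast H.prime.ne_zero
  have e3 : n = p * k := mul_right_cancel₀ hp0 (by linarith)
  rw [hn, e3, zpow_mul, zpow_natCast]

/-- On the fixed field `S` of `h`, `ρ` lies too deep in the ramification filtration: the trace of `ρ
x - x` would have the value of its leading term `p * (ρ x - x)`, yet it vanishes. -/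
theorem false_of_elementary_abelian (H : v.IsTotallyRamified p (p ^ 2) π) [FiniteDimensional ℚ L]
    [IsGalois ℚ L] (hcomm : ∀ σ τ : Gal(L/ℚ), σ * τ = τ * σ) (hexp : ∀ σ : Gal(L/ℚ), σ ^ p = 1)
    (hcard : Nat.card Gal(L/ℚ) = p ^ 2) (hp2 : 2 < p) : False := by
  have hp := H.prime
  have hlt : p < Nat.card Gal(L/ℚ) := by rw [hcard]; nlinarith
  obtain ⟨ρ, hρ1, hρ⟩ := H.exists_ne_one_map_sub_self_le hexp hlt
  have hρcard := card_zpowers_eq_prime hp hρ1 (hexp ρ)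
  obtain ⟨h, hh⟩ : ∃ h, h ∉ Subgroup.zpowers ρ := by
    by_contra! hcon
    rw [(Subgroup.eq_top_iff' _).2 hcon, Subgroup.card_top] at hρcard
    omega
  have hh1 : h ≠ 1 := fun e => hh (e ▸ one_mem _)
  have hhcard := card_zpowers_eq_prime hp hh1 (hexp h)
  have hρh : ρ ∉ Subgroup.zpowers h := fun hmem => by
    have hle : Subgroup.zpowers ρ ≤ Subgroup.zpowers h := by rwa [Subgroup.zpowers_le]
    have := Subgroup.eq_of_le_of_card_ge hle (by rw [hρcard, hhcard])
    exact hh (this ▸ Subgroup.mem_zpowers h)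
  set S := IntermediateField.fixedField (Subgroup.zpowers h) with hS
  have hmemS : ∀ x, x ∈ S ↔ h x = x := by
    intro x
    refine ⟨fun hx => hx ⟨h, Subgroup.mem_zpowers h⟩, fun hx => ?_⟩
    rintro ⟨g, hg⟩
    have : Subgroup.zpowers h ≤ MulAction.stabilizer Gal(L/ℚ) x := by
      rw [Subgroup.zpowers_le]
      exact hx
    exact this hg
  -- a uniformizer of `S`
  set ϖ := ∏ j ∈ Finset.range p, (h ^ j) π with hϖ
  have hvϖ : v ϖ = v π ^ p := by
    rw [hϖ, map_prod]
    simp [H.map_gal, -AlgEquiv.coe_pow]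
  have hϖS : ϖ ∈ S := by
    rw [hmemS]
    have e : ∀ i, h ((h ^ i) π) = (h ^ (i + 1)) π := fun i => by rw [pow_succ']; rfl
    have e2 := (Finset.prod_range_succ (fun i => (h ^ i) π) p).symm.trans
      (Finset.prod_range_succ' (fun i => (h ^ i) π) p)
    rw [hexp h, pow_zero] at e2
    rw [hϖ, map_prod]
    simp_rw [e]
    exact (mul_right_cancel₀ (by simpa using H.ne_zero) e2).symm
  have hϖpos : 0 < v ϖ := by rw [hvϖ]; exact pow_pos H.pos _
  have hϖ0 : ϖ ≠ 0 := by
    intro h0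
    rw [h0, map_zero] at hϖpos
    exact lt_irrefl _ hϖpos
  have hϖ1 : v ϖ < 1 := by rw [hvϖ]; exact pow_lt_one' H.lt_one hp.ne_zero
  have hSv : ∀ x ∈ S, x ≠ 0 → ∃ n : ℤ, v x = v ϖ ^ n := by
    intro x hx hx0
    rw [hvϖ]
    exact H.exists_zpow_of_mem_fixedField hcomm hexp hcard hh1 hρh hx hx0
  have hpϖ : v (p : L) = v ϖ ^ p := by rw [H.map_prime, hvϖ, ← pow_mul, pow_two]
  -- As `ρ` and `h` commute, `ρ ϖ / ϖ` is the `h`-norm of `ρ π / π = 1 + ε`, and `v π ^ (p + 1) = v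
  -- π * v ϖ`.
  have hρϖ : v (ρ ϖ - ϖ) ≤ v π * v ϖ * v ϖ := by
    set ε := ρ π / π - 1 with hε
    have hε2 : v ε ≤ v π ^ 2 := by
      have e1 : ε = (ρ π - π) / π := by
        have := H.ne_zero
        rw [hε]; field_simp
      rw [e1, map_div₀]
      exact div_le_of_le_mul₀ zero_le zero_le (hρ π)
    have hpc : v (p : L) ≤ v π ^ (p - 1) := by
      rw [H.map_prime]
      exact pow_le_pow_right_of_le_one' H.lt_one.le (by nlinarith [Nat.sub_le p 1])
    have key := v.map_prod_pow_sub_one_le hp h H.lt_one (H.map_gal h)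
      (H.map_sub_self_le (hexp h)) hpc H.map_prime_lt_one (hexp h) hε2
    have e1 : ρ ϖ = ϖ * ∏ j ∈ Finset.range p, (h ^ j) (1 + ε) := by
      rw [hϖ, map_prod, ← Finset.prod_mul_distrib]
      refine Finset.prod_congr rfl fun j _ => ?_
      rw [← AlgEquiv.mul_apply, hcomm, AlgEquiv.mul_apply, ← map_mul]
      congr 1
      have := H.ne_zero
      rw [hε]; field_simp; ring
    have e2 : ρ ϖ - ϖ = ϖ * (∏ j ∈ Finset.range p, (h ^ j) (1 + ε) - 1) := by rw [e1]; ring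
    rw [e2, map_mul, mul_comm]
    refine mul_le_mul_left (key.trans_eq ?_) _
    rw [hvϖ, pow_succ']
  have hstep : ∀ x ∈ S, v (ρ x - x) ≤ v π * v ϖ * v x := fun x hx =>
    H.map_sub_self_le_of_uniformizer S hϖS hϖ1 hϖ0 hSv
      (fun x _ => H.map_sub_self_le (hexp ρ) x) hρϖ hx
  have hmem : ∀ x ∈ S, ρ x - x ∈ S := by
    intro x hx
    rw [hmemS] at hx ⊢
    rw [_root_.map_sub, ← AlgEquiv.mul_apply, hcomm, AlgEquiv.mul_apply, hx]
  -- Nonzero elements of `S` have values in the powers of `v ϖ`, so the extra factor `v π < 1`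
  -- improves to a whole `v ϖ`.
  have hstep2 : ∀ x ∈ S, v (ρ x - x) ≤ v ϖ ^ 2 * v x := by
    intro x hx
    rcases eq_or_ne (ρ x - x) 0 with h0 | h0
    · simp [h0]
    have hx0 : x ≠ 0 := by rintro rfl; simp at h0
    obtain ⟨a, ha⟩ := hSv _ (hmem x hx) h0
    obtain ⟨b, hb⟩ := hSv _ hx hx0
    have h2 := hstep x hx
    have h3 : v ϖ ^ a < v ϖ ^ (b + 1) := by
      rw [← ha]
      refine h2.trans_lt ?_
      rw [hb, zpow_add_one₀ hϖpos.ne', mul_comm (v ϖ ^ b), mul_assoc]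
      exact mul_lt_of_lt_one_left (mul_pos hϖpos (zpow_pos hϖpos b)) H.lt_one
    have h4 : b + 1 < a := (zpow_lt_zpow_iff_right_of_lt_one₀ hϖpos hϖ1).1 h3
    rw [ha, hb, mul_comm, ← zpow_natCast, ← zpow_add₀ hϖpos.ne']
    exact zpow_le_zpow_right_of_le_one₀ hϖpos hϖ1.le (by push_cast; omega)
  -- an element moved by `ρ`
  obtain ⟨x, hxS, hx⟩ : ∃ x ∈ S, ρ x ≠ x := by
    by_contra! hcon
    refine hρh ?_
    rw [← IntermediateField.fixingSubgroup_fixedField (Subgroup.zpowers h),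
      IntermediateField.mem_fixingSubgroup_iff]
    exact hcon
  set y := ρ x - x with hy
  have hy0 : y ≠ 0 := sub_ne_zero.2 hx
  have hvy0 : 0 < v y := by simpa [zero_lt_iff] using hy0
  have hsum : ∑ j ∈ Finset.range p, (ρ ^ j) y = 0 := by
    have e : ∀ j, (ρ ^ j) y = (ρ ^ (j + 1)) x - (ρ ^ j) x := by
      intro j
      rw [hy, _root_.map_sub, pow_succ, AlgEquiv.mul_apply]
    simp_rw [e]
    rw [Finset.sum_range_sub (fun j => (ρ ^ j) x), hexp ρ]
    simp
  have hD : ∀ k, (((ρ : L →ₗ[ℚ] L) - 1 : Module.End ℚ L) ^ k) y ∈ S ∧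
      v ((((ρ : L →ₗ[ℚ] L) - 1 : Module.End ℚ L) ^ k) y) ≤ (v ϖ ^ 2) ^ k * v y := by
    intro k
    induction k with
    | zero => simpa using hmem x hxS
    | succ k ih =>
      rw [pow_succ', Module.End.mul_apply, pow_succ', mul_assoc]
      exact ⟨hmem _ ih.1, (hstep2 _ ih.1).trans (mul_le_mul_right ih.2 _)⟩
  rw [sum_pow_apply_eq_sum_choose] at hsum
  obtain ⟨m, rfl⟩ : ∃ m, p = m + 1 := ⟨p - 1, by omega⟩
  rw [Finset.sum_range_succ', add_eq_zero_iff_neg_eq] at hsum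
  have hpy : v ((m + 1 : ℕ) * y : L) = v ϖ ^ (m + 1) * v y := by rw [map_mul, hpϖ]
  have hpy0 : v ϖ ^ (m + 1) * v y ≠ 0 := (mul_pos (pow_pos hϖpos _) hvy0).ne'
  -- The vanishing trace equates `p * y`, up to sign, with the sum of the other terms, each of
  -- strictly smaller value.
  refine lt_irrefl (v ((m + 1 : ℕ) * y : L)) ?_
  have e0 : ((m + 1 : ℕ) : L) * y = ((m + 1).choose (0 + 1) : L) *
      ((((ρ : L →ₗ[ℚ] L) - 1 : Module.End ℚ L) ^ 0) y) := by simp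
  nth_rw 1 [e0]
  rw [← hsum, Valuation.map_neg, hpy]
  refine v.map_sum_lt hpy0 fun k hk => ?_
  rw [Finset.mem_range] at hk
  rw [map_mul]
  have hk1 := (hD (k + 1)).2
  have hlt1 : (v ϖ ^ 2) ^ (k + 1) < 1 :=
    pow_lt_one' (pow_lt_one' hϖ1 two_ne_zero) k.succ_ne_zero
  rcases (show k + 1 ≤ m from hk).eq_or_lt with hk' | hk'
  · rw [show k + 1 + 1 = m + 1 by omega, Nat.choose_self, Nat.cast_one, map_one, one_mul]
    refine hk1.trans_lt (mul_lt_mul_of_pos_right ?_ hvy0)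
    rw [← pow_mul]
    -- With `p = m + 1`, this is `p < 2 * (p - 1)`: the place where `p ≠ 2` is essential.
    exact pow_lt_pow_right_of_lt_one₀ hϖpos hϖ1 (by omega)
  · obtain ⟨l, hl⟩ := hp.dvd_choose_self (k + 1).succ_ne_zero (by omega)
    have hle : v ((m + 1).choose (k + 1 + 1) : L) ≤ v ϖ ^ (m + 1) := by
      rw [hl, Nat.cast_mul, map_mul, hpϖ]
      exact mul_le_of_le_one_right' (by simpa using v.map_intCast_le_one (l : ℤ))
    refine (mul_le_mul' hle hk1).trans_lt (mul_lt_mul_of_pos_left ?_ (pow_pos hϖpos _))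
    exact mul_lt_of_lt_one_left hvy0 hlt1

end Valuation.IsTotallyRamified

end NoElementaryAbelian

/-! ### Inertia groups, composita and total ramification -/

section Inertia

open Ideal

theorem Ideal.card_inertia_eq_ramificationIdx {G R S : Type*} [CommRing R] [CommRing S]
    [Algebra R S] [Group G] [Finite G] [MulSemiringAction G S] [IsGaloisGroup G R S] [IsDomain R]
    [IsDomain S] [Module.Finite R S] [Module.Flat R S] (P : Ideal S) [P.IsPrime]
    [PerfectField (P.under R).ResidueField] :
    Nat.card (P.inertia G) = P.ramificationIdx R := by
  rw [card_inertia_eq_ramificationIdxIn (P.under R) P,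
    ramificationIdxIn_eq_ramificationIdx (P.under R) P G]

/-- An automorphism of a compositum of normal extensions is determined by its restrictions. -/
theorem AlgEquiv.eq_one_of_restrictNormal_eq_one {k L : Type*} [Field k] [Field L] [Algebra k L]
    {F₁ F₂ : IntermediateField k L} [Normal k F₁] [Normal k F₂] (hsup : F₁ ⊔ F₂ = ⊤) {σ : Gal(L/k)}
    (e₁ : σ.restrictNormal F₁ = 1) (e₂ : σ.restrictNormal F₂ = 1) : σ = 1 := by
  have key : ∀ (F : IntermediateField k L) [Normal k F], σ.restrictNormal F = 1 →
      F ≤ IntermediateField.fixedField (Subgroup.zpowers σ) := by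
    intro F _ hres x hx
    rintro ⟨g, hg⟩
    have hst : Subgroup.zpowers σ ≤ MulAction.stabilizer Gal(L/k) x := by
      rw [Subgroup.zpowers_le, MulAction.mem_stabilizer_iff]
      have := AlgEquiv.restrictNormal_commutes σ F ⟨x, hx⟩
      rw [hres] at this
      exact this.symm
    exact hst hg
  have htop : (⊤ : IntermediateField k L) ≤ IntermediateField.fixedField (Subgroup.zpowers σ) :=
    hsup ▸ sup_le (key F₁ e₁) (key F₂ e₂)
  ext x
  exact htop (IntermediateField.mem_top (x := x)) ⟨σ, Subgroup.mem_zpowers σ⟩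

variable {E L : Type*} [Field E] [NumberField E] [Field L] [NumberField L] [Algebra E L]

theorem UnramifiedOutside.of_algebra {p : ℕ} (h : UnramifiedOutside p L) (E : Type*) [Field E]
    [NumberField E] [Algebra E L] : UnramifiedOutside p E := by
  intro Q hQ hQ0 hpQ
  obtain ⟨⟨P, hP, hPQ⟩⟩ := (inferInstance : Nonempty (Q.primesOver (𝓞 L)))
  have hP0 : P ≠ ⊥ := Ideal.ne_bot_of_liesOver_of_ne_bot hQ0 P
  have : Algebra.IsUnramifiedAt ℤ P := h P hP0 fun hp => hpQ <| by
    rw [hPQ.over, Ideal.mem_comap]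
    simpa using hp
  exact Algebra.IsUnramifiedAt.of_liesOver ℤ Q P

theorem inertia_eq_bot_iff_isUnramifiedAt [IsGalois ℚ L] (P : Ideal (𝓞 L)) [P.IsPrime] :
    P.inertia Gal(L/ℚ) = ⊥ ↔ Algebra.IsUnramifiedAt ℤ P := by
  have : IsGaloisGroup Gal(L/ℚ) ℤ (𝓞 L) := IsGaloisGroup.of_isFractionRing _ ℤ (𝓞 L) ℚ L
  rw [← Subgroup.card_eq_one, Ideal.card_inertia_eq_ramificationIdx (R := ℤ),
    Ideal.ramificationIdx_eq_one_iff]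

/-- A compositum of Galois extensions unramified outside `p` is unramified outside `p`. -/
theorem UnramifiedOutside.of_sup_eq_top [IsGalois ℚ L] {p : ℕ} {F₁ F₂ : IntermediateField ℚ L}
    [IsGalois ℚ F₁] [IsGalois ℚ F₂] (hsup : F₁ ⊔ F₂ = ⊤) (h₁ : UnramifiedOutside p F₁)
    (h₂ : UnramifiedOutside p F₂) : UnramifiedOutside p L := by
  intro P hP hP0 hpP
  rw [← inertia_eq_bot_iff_isUnramifiedAt, eq_bot_iff]
  intro σ hσ
  -- Restriction to `F` carries inertia at `P` into inertia at the prime below, which is trivial.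
  have key : ∀ (F : IntermediateField ℚ L) [IsGalois ℚ F], UnramifiedOutside p F →
      AlgEquiv.restrictNormal σ F = 1 := by
    intro F _ hF
    have hQ0 : P.under (𝓞 F) ≠ ⊥ := fun h => hP0 (Ideal.eq_bot_of_comap_eq_bot h)
    have hQ := hF (P.under (𝓞 F)) hQ0 fun hp => hpP <| by
      simpa [Ideal.mem_comap] using hp
    rw [← inertia_eq_bot_iff_isUnramifiedAt] at hQ
    have hres : AlgEquiv.restrictNormal σ F ∈ (P.under (𝓞 F)).inertia Gal(F/ℚ) := by
      intro x
      have h1 := hσ (algebraMap (𝓞 F) (𝓞 L) x)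
      rw [Submodule.mem_toAddSubgroup] at h1 ⊢
      rw [Ideal.under, Ideal.mem_comap]
      convert h1 using 1
      rw [map_sub]
      congr 1
      ext
      exact AlgEquiv.restrictNormal_commutes σ F (x : F)
    rwa [hQ, Subgroup.mem_bot] at hres
  rw [Subgroup.mem_bot]
  have n₁ : Normal ℚ F₁ := inferInstance
  have n₂ : Normal ℚ F₂ := inferInstance
  exact @AlgEquiv.eq_one_of_restrictNormal_eq_one ℚ L _ _ _ F₁ F₂ n₁ n₂ hsup σ (key F₁ h₁)
    (key F₂ h₂)

/-- An abelian extension of `ℚ` unramified outside `p` is totally ramified at `p`. -/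
theorem UnramifiedOutside.inertia_eq_top [IsGalois ℚ L] {p : ℕ} (hp : p.Prime)
    (hL : UnramifiedOutside p L) (hcomm : ∀ σ τ : Gal(L/ℚ), σ * τ = τ * σ) (P : Ideal (𝓞 L))
    [P.IsPrime] (hpP : (p : 𝓞 L) ∈ P) : P.inertia Gal(L/ℚ) = ⊤ := by
  set I := P.inertia Gal(L/ℚ) with hI
  set F : IntermediateField ℚ L := IntermediateField.fixedField I with hF
  have : I.Normal := ⟨fun n hn g => by rw [hcomm g n, mul_inv_cancel_right]; exact hn⟩
  have : IsGalois ℚ F := IsGalois.of_fixedField_normal_subgroup I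
  have : IsGaloisGroup I F L := IsGaloisGroup.subgroup Gal(L/ℚ) ℚ L I
  have : IsGaloisGroup Gal(L/ℚ) ℤ (𝓞 L) := IsGaloisGroup.of_isFractionRing _ ℤ (𝓞 L) ℚ L
  have : IsGaloisGroup I (𝓞 F) (𝓞 L) := IsGaloisGroup.of_isFractionRing _ (𝓞 F) (𝓞 L) F L
  -- The ramification index of `P` over `F` is already `Nat.card I`, the index over `ℤ`;
  -- multiplicativity leaves `F` unramified below `P`.
  have h1 : Nat.card (P.inertia I) = Nat.card I := by
    have : P.inertia I = ⊤ := by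
      rw [eq_top_iff]
      intro σ _
      exact Ideal.coe_mem_inertia.1 σ.2
    rw [this, Subgroup.card_top]
  have h2 := Ideal.card_inertia_eq_ramificationIdx (G := Gal(L/ℚ)) (R := ℤ) P
  have h3 := Ideal.card_inertia_eq_ramificationIdx (G := I) (R := 𝓞 F) P
  have h4 := Ideal.ramificationIdx_tower (R := ℤ) (P.under (𝓞 F)) P
  have h5 : (P.under (𝓞 F)).ramificationIdx ℤ = 1 := by
    rw [← h2, ← h3, h1] at h4
    exact (Nat.eq_of_mul_eq_mul_right Nat.card_pos (by rw [one_mul]; exact h4)).symm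
  rw [Ideal.ramificationIdx_eq_one_iff] at h5
  by_contra hne
  have hrank : 1 < Module.finrank ℚ F := by
    have hpos : 0 < Module.finrank ℚ F := Module.finrank_pos
    refine lt_of_le_of_ne hpos fun h => hne ?_
    rw [← IntermediateField.fixingSubgroup_fixedField I, ← hF,
      IntermediateField.finrank_eq_one_iff.1 h.symm, IntermediateField.fixingSubgroup_bot]
  -- Minkowski: if `F ≠ ℚ`, some `q` has only ramified primes above it. `h5` excludes `q = p`, and
  -- `hL` excludes the rest.
  obtain ⟨q, hq, hram⟩ := NumberField.exists_not_isUnramifiedAt_int_of_isGalois (𝒪 := 𝓞 F) hrank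
  rcases eq_or_ne q p with rfl | hqp
  · exact hram _ inferInstance (by simpa [Ideal.under, Ideal.mem_comap] using hpP) h5
  · have hqZ : (Ideal.span {(q : ℤ)}).IsPrime :=
      (Ideal.span_singleton_prime (by exact_mod_cast hq.ne_zero)).2 (Nat.prime_iff_prime_int.1 hq)
    obtain ⟨⟨Q, hQ, hQq⟩⟩ := (inferInstance : Nonempty ((Ideal.span {(q : ℤ)}).primesOver (𝓞 F)))
    have hqQ : (q : 𝓞 F) ∈ Q := by
      have : (q : ℤ) ∈ Ideal.span {(q : ℤ)} := Ideal.mem_span_singleton_self _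
      rw [hQq.over, Ideal.mem_comap] at this
      simpa using this
    refine hram Q hQ hqQ (hL.of_algebra F Q ?_ fun hpQ => ?_)
    · rintro rfl
      exact hq.ne_zero (by simpa using hqQ)
    · have hc := (Nat.isCoprime_iff_coprime.2 ((Nat.coprime_primes hq hp).2 hqp)).map
        (Int.castRingHom (𝓞 F))
      obtain ⟨a, b, hab⟩ := hc
      refine hQ.ne_top ((Ideal.eq_top_iff_one _).2 ?_)
      rw [← hab]
      exact Q.add_mem (Q.mul_mem_left _ (by simpa using hqQ)) (Q.mul_mem_left _ (by simpa using hpQ))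

end Inertia

/-! ### From number fields to the valuation above p -/

section Global

open Ideal IsDedekindDomain

variable {L : Type*} [Field L] [NumberField L] [IsGalois ℚ L] {p : ℕ}

/-- The valuation of the prime above `p` in an abelian extension unramified outside `p`. -/
theorem UnramifiedOutside.exists_isTotallyRamified (hp : p.Prime) (hL : UnramifiedOutside p L)
    (hcomm : ∀ σ τ : Gal(L/ℚ), σ * τ = τ * σ) :
    ∃ (v : Valuation L (WithZero (Multiplicative ℤ))) (π : L),
      v.IsTotallyRamified p (Nat.card Gal(L/ℚ)) π := by
  have : IsGaloisGroup Gal(L/ℚ) ℤ (𝓞 L) := IsGaloisGroup.of_isFractionRing _ ℤ (𝓞 L) ℚ L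
  have hpprime : (span {(p : ℤ)}).IsPrime :=
    (span_singleton_prime (by exact_mod_cast hp.ne_zero)).2 (Nat.prime_iff_prime_int.1 hp)
  have hp0 : span {(p : ℤ)} ≠ ⊥ := by simpa using hp.ne_zero
  obtain ⟨⟨P, hP, hPp⟩⟩ := (inferInstance : Nonempty ((span {(p : ℤ)}).primesOver (𝓞 L)))
  have hP0 : P ≠ ⊥ := Ideal.ne_bot_of_liesOver_of_ne_bot hp0 P
  have hpP : (p : 𝓞 L) ∈ P := by
    have : (p : ℤ) ∈ span {(p : ℤ)} := mem_span_singleton_self _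
    rw [hPp.over, mem_comap] at this
    simpa using this
  have hin := hL.inertia_eq_top hp hcomm P hpP
  have hcard := Ideal.card_inertia_eq_ramificationIdx (G := Gal(L/ℚ)) (R := ℤ) P
  rw [hin, Subgroup.card_top] at hcard
  -- In the identity `g * e * f = |G|`, total ramification `e = |G|` forces `f = 1`.
  have hf : P.inertiaDeg ℤ = 1 := by
    have h := ncard_primesOver_mul_card_inertia_mul_finrank (G := Gal(L/ℚ)) (span {(p : ℤ)}) P
    rw [hin, Subgroup.card_top] at h
    have : Nat.card Gal(L/ℚ) * ((span {(p : ℤ)}).primesOver (𝓞 L)).ncard * P.inertiaDeg ℤ =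
        Nat.card Gal(L/ℚ) * 1 := by rw [mul_one, mul_comm (Nat.card _)]; exact h
    rw [mul_assoc] at this
    exact Nat.eq_one_of_mul_eq_one_left (Nat.eq_of_mul_eq_mul_left Nat.card_pos this)
  have hsurj : ∀ x : 𝓞 L, ∃ n : ℤ, x - n ∈ P := by
    have hmax : (span {(p : ℤ)}).IsMaximal := hpprime.isMaximal hp0
    have hPmax : P.IsMaximal := hP.isMaximal hP0
    let : Field (ℤ ⧸ span {(p : ℤ)}) := Quotient.field _
    rw [inertiaDeg_eq_of_isMaximal (span {(p : ℤ)}) P] at hf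
    have hb := Algebra.finrank_eq_one_iff_bijective_algebraMap.1 hf
    intro x
    obtain ⟨y, hy⟩ := hb.2 (Ideal.Quotient.mk P x)
    obtain ⟨n, rfl⟩ := Ideal.Quotient.mk_surjective y
    refine ⟨n, ?_⟩
    rw [← Ideal.Quotient.mk_eq_mk_iff_sub_mem, ← hy]
    simp
  let w : HeightOneSpectrum (𝓞 L) := ⟨P, hP, hP0⟩
  obtain ⟨π, hπ⟩ := w.valuation_exists_uniformizer L
  have hπ0 : π ≠ 0 := by
    rintro rfl
    rw [map_zero] at hπ
    exact WithZero.exp_ne_zero hπ.symm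
  refine ⟨w.valuation L, π, hp, Nat.card_pos.ne', hπ0, ?_, ?_, ?_, ?_, ?_⟩
  · rw [hπ, ← WithZero.exp_zero, WithZero.exp_lt_exp]
    norm_num
  · intro x hx
    have hvx : w.valuation L x ≠ 0 := by simpa using hx
    refine ⟨-WithZero.log (w.valuation L x), ?_⟩
    rw [hπ, ← WithZero.exp_zsmul]
    simp [WithZero.exp_log hvx]
  · intro x hx
    obtain ⟨a, ha⟩ := w.exists_valuation_sub_lt_of_integer (K := L) hx 1
    obtain ⟨n, hn⟩ := hsurj a
    refine ⟨n, ?_⟩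
    have e : x - n = algebraMap (𝓞 L) L (a - n) - (algebraMap (𝓞 L) L a - x) := by
      rw [map_sub, map_intCast]; ring
    rw [e]
    exact (w.valuation L).map_sub_lt ((w.valuation_lt_one_iff_mem _).2 hn) (by simpa using ha)
  · have e1 : (p : L) = algebraMap (𝓞 L) L p := by simp
    have hpne : (p : 𝓞 L) ≠ 0 := by exact_mod_cast hp.ne_zero
    rw [e1, w.valuation_of_algebraMap, w.intValuation_eq_exp_neg_multiplicity hpne, hπ, hcard,
      Ideal.IsDedekindDomain.ramificationIdx_eq_multiplicity (span {(p : ℤ)}) P]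
    · rw [map_span, Set.image_singleton]
      rw [← WithZero.exp_nsmul]
      simp [w]
    · rw [map_span, Set.image_singleton, ne_eq, span_singleton_eq_bot]
      simpa using hp.ne_zero
  · intro σ x
    have hle : ∀ (τ : Gal(L/ℚ)) (y : 𝓞 L), w.valuation L (τ (algebraMap (𝓞 L) L y)) =
        w.valuation L (algebraMap (𝓞 L) L y) := by
      have hle : ∀ (τ : Gal(L/ℚ)) (y : 𝓞 L), w.valuation L (τ (algebraMap (𝓞 L) L y)) ≤
          w.valuation L (algebraMap (𝓞 L) L y) := by
        intro τ y
        rcases eq_or_ne y 0 with rfl | hy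
        · simp
        have e : τ (algebraMap (𝓞 L) L y) = algebraMap (𝓞 L) L (τ • y) := rfl
        -- Every `τ` is in the inertia group, so `τ z ≡ z` modulo `P`.
        have hPτ : P ≤ P.comap (MulSemiringAction.toRingHom Gal(L/ℚ) (𝓞 L) τ) := by
          intro z hz
          have hτ : τ ∈ P.inertia Gal(L/ℚ) := hin ▸ Subgroup.mem_top τ
          have := P.add_mem (hτ z) hz
          rwa [sub_add_cancel] at this
        rw [e, w.valuation_of_algebraMap, w.valuation_of_algebraMap,
          w.intValuation_eq_exp_neg_multiplicity hy, w.intValuation_le_pow_iff_mem]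
        refine (Ideal.pow_right_mono hPτ _).trans (Ideal.le_comap_pow _ _) ?_
        rw [← w.intValuation_le_pow_iff_mem, w.intValuation_eq_exp_neg_multiplicity hy]
      intro τ y
      refine le_antisymm (hle τ y) ?_
      have := hle τ⁻¹ (τ • y)
      have e : τ (algebraMap (𝓞 L) L y) = algebraMap (𝓞 L) L (τ • y) := rfl
      rwa [← e, ← AlgEquiv.mul_apply, inv_mul_cancel, AlgEquiv.one_apply] at this
    obtain ⟨y, z, hz, rfl⟩ := IsFractionRing.div_surjective (A := 𝓞 L) x
    rw [map_div₀, map_div₀, map_div₀, hle, hle]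

theorem UnramifiedOutside.false_of_elementary_abelian (hp : p.Prime) (hp2 : 2 < p)
    (hL : UnramifiedOutside p L) (hcomm : ∀ σ τ : Gal(L/ℚ), σ * τ = τ * σ)
    (hexp : ∀ σ : Gal(L/ℚ), σ ^ p = 1) (hcard : Nat.card Gal(L/ℚ) = p ^ 2) : False := by
  obtain ⟨v, π, H⟩ := hL.exists_isTotallyRamified hp hcomm
  rw [hcard] at H
  exact H.false_of_elementary_abelian hcomm hexp hcard hp2

end Global

/-! ### Abelian p-groups -/

section GroupTheory

/-- Burnside's basis theorem for abelian `p`-groups, in rank one. -/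
theorem IsPGroup.isCyclic_of_quotient_range_powMonoidHom {G : Type*} [CommGroup G] [Finite G] {p : ℕ}
    [hp : Fact p.Prime] (hG : IsPGroup p G) (hc : IsCyclic (G ⧸ (powMonoidHom p : G →* G).range)) :
    IsCyclic G := by
  obtain ⟨q, hg⟩ := hc.exists_generator
  obtain ⟨g, rfl⟩ := QuotientGroup.mk_surjective q
  refine ⟨g, ?_⟩
  suffices h : Subgroup.zpowers g = ⊤ from fun x => (Subgroup.eq_top_iff' _).1 h x
  -- Modulo `g` every element is a `p`-th power. On a finite group the `p`-th power map is then
  -- injective, which no nontrivial `p`-group allows.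
  have hsurj : Function.Surjective (powMonoidHom p : G ⧸ Subgroup.zpowers g →* _) := by
    intro w
    obtain ⟨x, rfl⟩ := QuotientGroup.mk_surjective w
    obtain ⟨k, hk⟩ := hg x
    have hk' : ((g ^ k : G) : G ⧸ (powMonoidHom p : G →* G).range) = x := hk
    obtain ⟨y, hy⟩ := QuotientGroup.eq.1 hk'
    refine ⟨(y : G), ?_⟩
    change ((y ^ p : G) : G ⧸ Subgroup.zpowers g) = (x : G ⧸ Subgroup.zpowers g)
    rw [QuotientGroup.eq, show y ^ p = (g ^ k)⁻¹ * x from hy]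
    simp
  have hinj := Finite.injective_iff_surjective.2 hsurj
  rcases subsingleton_or_nontrivial (G ⧸ Subgroup.zpowers g) with hs | hs
  · exact QuotientGroup.subgroup_eq_top_of_subsingleton _ hs
  · exfalso
    obtain ⟨n, hn, hcard⟩ := (hG.to_quotient (Subgroup.zpowers g)).nontrivial_iff_card.1 hs
    obtain ⟨x, hx⟩ := exists_prime_orderOf_dvd_card' (G := G ⧸ Subgroup.zpowers g) p
      (hcard ▸ dvd_pow_self p hn.ne')
    have hx1 : x = 1 := hinj <| by
      change x ^ p = 1 ^ p
      rw [one_pow, ← hx, pow_orderOf_eq_one]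
    rw [hx1, orderOf_one] at hx
    exact hp.out.one_lt.ne hx

/-- The quotient by `p`-th powers has order `p ^ d` with `d ≥ 2`; a subgroup of order `p ^ (d - 2)`
pulls back to `N`. -/
theorem IsPGroup.exists_index_eq_sq_of_not_isCyclic {G : Type*} [CommGroup G] [Finite G] {p : ℕ}
    [hp : Fact p.Prime] (hG : IsPGroup p G) (hc : ¬ IsCyclic G) :
    ∃ N : Subgroup G, N.index = p ^ 2 ∧ ∀ g : G, g ^ p ∈ N := by
  obtain ⟨d, hd⟩ := (IsPGroup.iff_card (p := p)).1
    (hG.to_quotient (powMonoidHom p : G →* G).range)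
  have h2 : 2 ≤ d := by
    by_contra! h
    refine hc (hG.isCyclic_of_quotient_range_powMonoidHom ?_)
    interval_cases d
    · have := (Nat.card_eq_one_iff_unique.1 (hd.trans (pow_zero p))).1
      infer_instance
    · exact isCyclic_of_prime_card (hd.trans (pow_one p))
  obtain ⟨N, hN⟩ := Sylow.exists_subgroup_card_pow_prime (G := G ⧸ (powMonoidHom p : G →* G).range)
    p (n := d - 2) (hd ▸ pow_dvd_pow p (Nat.sub_le d 2))
  refine ⟨N.comap (QuotientGroup.mk' _), ?_, fun g => ?_⟩
  · rw [Subgroup.index_comap_of_surjective _ (QuotientGroup.mk'_surjective _)]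
    have h := N.card_mul_index
    rw [hN, hd, show d = (d - 2) + 2 by omega, pow_add, Nat.add_sub_cancel] at h
    exact Nat.eq_of_mul_eq_mul_left (pow_pos hp.out.pos _) h
  · rw [Subgroup.mem_comap]
    have : QuotientGroup.mk' (powMonoidHom p : G →* G).range (g ^ p) = 1 :=
      (QuotientGroup.eq_one_iff _).2 ⟨g, rfl⟩
    rw [this]
    exact one_mem N

end GroupTheory

/-! ### Uniqueness inside a compositum -/

section Compositum

open IntermediateField

variable {L : Type*} [Field L] [NumberField L] [IsGalois ℚ L] {p : ℕ}

/-- An abelian `p`-extension of `ℚ` unramified outside an odd prime `p` is cyclic. -/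
theorem UnramifiedOutside.isCyclic_of_isPGroup (hp : p.Prime) (hp2 : 2 < p)
    (hL : UnramifiedOutside p L) (hcomm : ∀ σ τ : Gal(L/ℚ), σ * τ = τ * σ)
    (hG : IsPGroup p Gal(L/ℚ)) : IsCyclic Gal(L/ℚ) := by
  have : Fact p.Prime := ⟨hp⟩
  by_contra hc
  let : CommGroup Gal(L/ℚ) := { (inferInstance : Group Gal(L/ℚ)) with mul_comm := hcomm }
  obtain ⟨N, hN, hpow⟩ := hG.exists_index_eq_sq_of_not_isCyclic hc
  have hnorm : N.Normal := inferInstance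
  have : IsGalois ℚ (fixedField N) := IsGalois.of_fixedField_normal_subgroup N
  let e : Gal(L/ℚ) ⧸ N ≃* Gal(fixedField N/ℚ) := IsGalois.normalAutEquivQuotient N
  refine (hL.of_algebra (fixedField N)).false_of_elementary_abelian hp hp2 ?_ ?_ ?_
  · intro σ τ
    apply e.symm.injective
    rw [map_mul, map_mul, mul_comm]
  · intro σ
    rw [← e.apply_symm_apply σ]
    obtain ⟨g, hg⟩ := QuotientGroup.mk_surjective (e.symm σ)
    rw [← hg, ← map_pow, ← QuotientGroup.mk_pow, (QuotientGroup.eq_one_iff _).2 (hpow g), map_one]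
  · rw [← Nat.card_congr e.toEquiv]
    exact hN

/-- The Galois group of the compositum is cyclic and killed by `p ^ m`, so the degree is at most `p
^ m` and both fields are everything. -/
theorem eq_of_unramifiedOutside_of_sup_eq_top {m : ℕ} (hp : p.Prime) (hp2 : 2 < p)
    {F₁ F₂ : IntermediateField ℚ L} [IsGalois ℚ F₁] [IsGalois ℚ F₂] [IsCyclic Gal(F₁/ℚ)]
    [IsCyclic Gal(F₂/ℚ)] (hd₁ : Module.finrank ℚ F₁ = p ^ m) (hd₂ : Module.finrank ℚ F₂ = p ^ m)
    (h₁ : UnramifiedOutside p F₁) (h₂ : UnramifiedOutside p F₂) (hsup : F₁ ⊔ F₂ = ⊤) :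
    F₁ = F₂ := by
  have hL : UnramifiedOutside p L := .of_sup_eq_top hsup h₁ h₂
  have hinj : ∀ σ τ : Gal(L/ℚ),
      AlgEquiv.restrictNormalHom F₁ σ = AlgEquiv.restrictNormalHom F₁ τ →
      AlgEquiv.restrictNormalHom F₂ σ = AlgEquiv.restrictNormalHom F₂ τ → σ = τ := by
    intro σ τ e₁ e₂
    have n₁ : Normal ℚ F₁ := inferInstance
    have n₂ : Normal ℚ F₂ := inferInstance
    rw [← inv_mul_eq_one]
    refine @AlgEquiv.eq_one_of_restrictNormal_eq_one ℚ L _ _ _ F₁ F₂ n₁ n₂ hsup _ ?_ ?_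
    · change AlgEquiv.restrictNormalHom F₁ (σ⁻¹ * τ) = 1
      rw [map_mul, map_inv, e₁, inv_mul_cancel]
    · change AlgEquiv.restrictNormalHom F₂ (σ⁻¹ * τ) = 1
      rw [map_mul, map_inv, e₂, inv_mul_cancel]
  have hcomm : ∀ σ τ : Gal(L/ℚ), σ * τ = τ * σ := by
    intro σ τ
    let := IsCyclic.commGroup (α := Gal(F₁/ℚ))
    let := IsCyclic.commGroup (α := Gal(F₂/ℚ))
    exact hinj _ _ (by rw [map_mul, map_mul]; exact mul_comm _ _)
      (by rw [map_mul, map_mul]; exact mul_comm _ _)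
  have hexp : ∀ σ : Gal(L/ℚ), σ ^ p ^ m = 1 := by
    intro σ
    have key : ∀ (F : IntermediateField ℚ L) [IsGalois ℚ F], Module.finrank ℚ F = p ^ m →
        AlgEquiv.restrictNormalHom F (σ ^ p ^ m) =
          AlgEquiv.restrictNormalHom F (1 : Gal(L/ℚ)) := by
      intro F _ hF
      rw [map_pow, ← hF, ← IsGalois.card_aut_eq_finrank, pow_card_eq_one', map_one]
    exact hinj _ _ (key F₁ hd₁) (key F₂ hd₂)
  have hcyc := hL.isCyclic_of_isPGroup hp hp2 hcomm fun σ => ⟨m, hexp σ⟩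
  obtain ⟨g, hg⟩ := hcyc.exists_generator
  have hle : Module.finrank ℚ L ≤ p ^ m := by
    rw [← IsGalois.card_aut_eq_finrank, ← orderOf_eq_card_of_forall_mem_zpowers hg]
    exact Nat.le_of_dvd (pow_pos hp.pos _) (orderOf_dvd_of_pow_eq_one (hexp g))
  have htop : ∀ F : IntermediateField ℚ L, Module.finrank ℚ F = p ^ m → F = ⊤ := by
    intro F hF
    exact eq_of_le_of_finrank_le le_top (by rw [finrank_top', hF]; exact hle)
  rw [htop F₁ hd₁, htop F₂ hd₂]

end Compositum

/-! ### Comparison with subfields of cyclotomic fields -/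

section Subfields

open IntermediateField

variable {Ω : Type*} [Field Ω] [CharZero Ω] {p m : ℕ}

theorem UnramifiedOutside.of_ringEquiv {K M : Type*} [Field K] [NumberField K] [Field M]
    [NumberField M] (e : M ≃+* K) (h : UnramifiedOutside p K) : UnramifiedOutside p M :=
  let _ : Algebra M K := e.toRingHom.toAlgebra
  h.of_algebra M

/-- Transport of the hypotheses on a cyclic extension along an isomorphism. -/
theorem UnramifiedOutside.transfer {K M : Type*} [Field K] [NumberField K] [Field M] [CharZero M]
    [IsGalois ℚ K] [IsCyclic Gal(K/ℚ)] (e : K ≃ₐ[ℚ] M) (h : UnramifiedOutside p K) :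
    IsGalois ℚ M ∧ IsCyclic Gal(M/ℚ) ∧ Module.finrank ℚ M = Module.finrank ℚ K ∧
      UnramifiedOutside p M := by
  have : FiniteDimensional ℚ M := e.toLinearEquiv.finiteDimensional
  have : NumberField M := ⟨⟩
  exact ⟨IsGalois.of_algEquiv e, isCyclic_of_surjective e.autCongr e.autCongr.surjective,
    e.toLinearEquiv.finrank_eq.symm, h.of_ringEquiv e.toRingEquiv.symm⟩

theorem eq_of_unramifiedOutside (hp : p.Prime) (hp2 : 2 < p) {K M : IntermediateField ℚ Ω}
    [IsGalois ℚ K] [IsGalois ℚ M] [IsCyclic Gal(K/ℚ)] [IsCyclic Gal(M/ℚ)] [NumberField K]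
    [NumberField M] (hdK : Module.finrank ℚ K = p ^ m) (hdM : Module.finrank ℚ M = p ^ m)
    (hK : UnramifiedOutside p K) (hM : UnramifiedOutside p M) : K = M := by
  have f₁ : FiniteDimensional ℚ K := NumberField.to_finiteDimensional (K := K)
  have f₂ : FiniteDimensional ℚ M := NumberField.to_finiteDimensional (K := M)
  have f₃ : FiniteDimensional ℚ ↥(K ⊔ M) := finiteDimensional_sup K M
  have : NumberField ↥(K ⊔ M) := { to_charZero := inferInstance, to_finiteDimensional := f₃ }
  have : IsGalois ℚ ↥(K ⊔ M) := by
    have n₁ : @Normal ℚ K _ _ K.algebra' := ‹IsGalois ℚ K›.to_normal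
    have n₂ : @Normal ℚ M _ _ M.algebra' := ‹IsGalois ℚ M›.to_normal
    have n₃ : @Normal ℚ ↥(K ⊔ M) _ _ (K ⊔ M).algebra' := normal_sup ℚ Ω K M
    have n₄ : Normal ℚ ↥(K ⊔ M) := n₃
    exact { }
  have hsup : restrict (le_sup_left : K ≤ K ⊔ M) ⊔ restrict (le_sup_right : M ≤ K ⊔ M) = ⊤ := by
    apply lift_injective
    rw [lift_sup, lift_restrict, lift_restrict, lift_top]
  let e₁ : K ≃ₐ[ℚ] restrict (le_sup_left : K ≤ K ⊔ M) := restrictAlgEquiv le_sup_left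
  let e₂ : M ≃ₐ[ℚ] restrict (le_sup_right : M ≤ K ⊔ M) := restrictAlgEquiv le_sup_right
  obtain ⟨_, _, d₁, u₁⟩ := hK.transfer e₁
  obtain ⟨_, _, d₂, u₂⟩ := hM.transfer e₂
  have := congrArg lift
    (eq_of_unramifiedOutside_of_sup_eq_top hp hp2 (d₁.trans hdK) (d₂.trans hdM) u₁ u₂ hsup)
  rwa [lift_restrict, lift_restrict] at this

/-- A cyclotomic field of conductor a power of `p` is unramified outside `p`. -/
theorem UnramifiedOutside.of_isCyclotomicExtension (hp : p.Prime) (k : ℕ) (C : Type*) [Field C]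
    [NumberField C] [IsCyclotomicExtension {p ^ k} ℚ C] : UnramifiedOutside p C := by
  intro Q hQ hQ0 hpQ
  have : NeZero (p ^ k) := ⟨pow_ne_zero _ hp.ne_zero⟩
  have hmax : Q.IsMaximal := hQ.isMaximal hQ0
  have hprime : (Q.under ℤ).IsPrime := inferInstance
  have hu0 : Q.under ℤ ≠ ⊥ := fun h => hQ0 (Ideal.eq_bot_of_comap_eq_bot h)
  obtain ⟨q, hq⟩ : ∃ q : ℤ, Q.under ℤ = Ideal.span {q} :=
    ⟨_, (Submodule.IsPrincipal.span_singleton_generator (Q.under ℤ)).symm⟩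
  have hq0 : q ≠ 0 := by rintro rfl; exact hu0 (by simpa using hq)
  rw [hq, Ideal.span_singleton_prime hq0] at hprime
  have hq' : Q.under ℤ = Ideal.span {(q.natAbs : ℤ)} := by rw [hq, Int.span_natAbs]
  have hqprime : Fact q.natAbs.Prime := ⟨Int.prime_iff_natAbs_prime.1 hprime⟩
  have : Q.LiesOver (Ideal.span {(q.natAbs : ℤ)}) := ⟨hq'.symm⟩
  have hqp : ¬ q.natAbs ∣ p ^ k := fun hd => by
    have h1 := (Nat.prime_dvd_prime_iff_eq hqprime.out hp).1 (hqprime.out.dvd_of_dvd_pow hd)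
    have h2 : (p : ℤ) ∈ Q.under ℤ := by
      rw [hq', h1]
      exact Ideal.mem_span_singleton_self _
    exact hpQ (by simpa [Ideal.under, Ideal.mem_comap] using h2)
  rw [← Ideal.ramificationIdx_eq_one_iff]
  exact IsCyclotomicExtension.Rat.ramificationIdx_eq_of_not_dvd q.natAbs C Q hqp

theorem isCyclic_gal_of_isCyclotomicExtension (hp : p.Prime) (hp2 : 2 < p) (k : ℕ) (C : Type*)
    [Field C] [CharZero C] [IsCyclotomicExtension {p ^ k} ℚ C] : IsCyclic Gal(C/ℚ) := by
  have : NeZero (p ^ k) := ⟨pow_ne_zero _ hp.ne_zero⟩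
  have := ZMod.isCyclic_units_of_prime_pow p hp hp2.ne' k
  let e := IsCyclotomicExtension.autEquivPow C
    (Polynomial.cyclotomic.irreducible_rat (n := p ^ k) (NeZero.pos _))
  exact isCyclic_of_surjective e.symm e.symm.surjective

/-- Subfields of a cyclic extension are cyclic. -/
theorem isGalois_isCyclic_of_isCyclic {C : Type*} [Field C] [NumberField C] [IsGalois ℚ C]
    [IsCyclic Gal(C/ℚ)] (F : IntermediateField ℚ C) : IsGalois ℚ F ∧ IsCyclic Gal(F/ℚ) := by
  let := IsCyclic.commGroup (α := Gal(C/ℚ))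
  have hn : F.fixingSubgroup.Normal := ⟨fun n hn g => by rwa [mul_comm g n, mul_inv_cancel_right]⟩
  have h2 : IsGalois ℚ F := (InfiniteGalois.normal_iff_isGalois F).1 hn
  exact ⟨h2, isCyclic_of_surjective (AlgEquiv.restrictNormalHom F : Gal(C/ℚ) →* _)
    (AlgEquiv.restrictNormalHom_surjective C)⟩

theorem exists_finrank_eq_of_isCyclic {C : Type*} [Field C] [NumberField C] [IsGalois ℚ C]
    [IsCyclic Gal(C/ℚ)] {d : ℕ} (hd : d ∣ Module.finrank ℚ C) :
    ∃ F : IntermediateField ℚ C, Module.finrank ℚ F = d := by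
  obtain ⟨g, hg⟩ := IsCyclic.exists_generator (α := Gal(C/ℚ))
  have hg' : orderOf g = Module.finrank ℚ C := by
    rw [orderOf_eq_card_of_forall_mem_zpowers hg, IsGalois.card_aut_eq_finrank]
  have hpos : 0 < Module.finrank ℚ C := Module.finrank_pos
  have hd0 : d ≠ 0 := by rintro rfl; exact hpos.ne' (zero_dvd_iff.1 hd)
  -- The subgroup generated by `g ^ d` has index `d`.
  refine ⟨fixedField (Subgroup.zpowers (g ^ d)), ?_⟩
  have h1 := finrank_fixedField_eq_card (Subgroup.zpowers (g ^ d))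
  rw [Nat.card_zpowers, orderOf_pow_of_dvd hd0 (hg' ▸ hd), hg'] at h1
  have h2 := Module.finrank_mul_finrank ℚ (fixedField (Subgroup.zpowers (g ^ d))) C
  rw [h1] at h2
  obtain ⟨c, hc⟩ := hd
  rw [hc, Nat.mul_div_cancel_left _ (Nat.pos_of_ne_zero hd0)] at h2
  have hc0 : 0 < c := Nat.pos_of_ne_zero (by rintro rfl; omega)
  exact Nat.eq_of_mul_eq_mul_right hc0 h2

theorem isCyclotomicExtension_adjoin_zeta {n : ℕ} [NeZero n] {ζ : Ω} (hζ : IsPrimitiveRoot ζ n) :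
    IsCyclotomicExtension {n} ℚ ℚ⟮ζ⟯ := by
  have h : IsCyclotomicExtension {n} ℚ (ℚ⟮ζ⟯).toSubalgebra := by
    rw [adjoin_simple_toSubalgebra_of_isAlgebraic
      (hζ.isIntegral (NeZero.pos n)).tower_top.isAlgebraic]
    exact hζ.adjoin_isCyclotomicExtension ℚ
  exact h

/-- A cyclic extension of degree `p ^ m` unramified outside `p` is the subfield of degree `p ^ m`
of `ℚ(ζ)` for a primitive `p ^ (m + 1)`-th root of unity `ζ`. -/
theorem eq_of_le_adjoin_zeta (hp : p.Prime) (hp2 : 2 < p) {K L : IntermediateField ℚ Ω}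
    [NumberField K] [IsGalois ℚ K] [IsCyclic Gal(K/ℚ)] (hdeg : Module.finrank ℚ K = p ^ m)
    (hunr : UnramifiedOutside p K) {ζ : Ω} (hζ : IsPrimitiveRoot ζ (p ^ (m + 1))) (hL : L ≤ ℚ⟮ζ⟯)
    (hLdeg : Module.finrank ℚ L = p ^ m) : K = L := by
  have : NeZero (p ^ (m + 1)) := ⟨pow_ne_zero _ hp.ne_zero⟩
  have hC : IsCyclotomicExtension {p ^ (m + 1)} ℚ ℚ⟮ζ⟯ := isCyclotomicExtension_adjoin_zeta hζ
  have : NumberField ℚ⟮ζ⟯ := IsCyclotomicExtension.numberField {p ^ (m + 1)} ℚ _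
  have : IsGalois ℚ ℚ⟮ζ⟯ := IsCyclotomicExtension.isGalois {p ^ (m + 1)} ℚ _
  have : IsCyclic Gal(ℚ⟮ζ⟯/ℚ) := isCyclic_gal_of_isCyclotomicExtension hp hp2 (m + 1) _
  have hu : UnramifiedOutside p ℚ⟮ζ⟯ := .of_isCyclotomicExtension hp (m + 1) _
  let F : IntermediateField ℚ ℚ⟮ζ⟯ := restrict hL
  obtain ⟨_, _⟩ := isGalois_isCyclic_of_isCyclic F
  let e : F ≃ₐ[ℚ] L := (restrictAlgEquiv hL).symm
  obtain ⟨_, _, _, u⟩ := (hu.of_algebra F).transfer e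
  have : NumberField L :=
    { to_charZero := inferInstance
      to_finiteDimensional := e.toLinearEquiv.finiteDimensional }
  exact eq_of_unramifiedOutside hp hp2 hdeg hLdeg hunr u

/-- The cyclic field `ℚ⟮ζ⟯` has degree `p ^ m * (p - 1)`. -/
theorem exists_le_adjoin_zeta (hp : p.Prime) (hp2 : 2 < p) {ζ : Ω}
    (hζ : IsPrimitiveRoot ζ (p ^ (m + 1))) :
    ∃ L : IntermediateField ℚ Ω, L ≤ ℚ⟮ζ⟯ ∧ Module.finrank ℚ L = p ^ m := by
  have : NeZero (p ^ (m + 1)) := ⟨pow_ne_zero _ hp.ne_zero⟩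
  have hC : IsCyclotomicExtension {p ^ (m + 1)} ℚ ℚ⟮ζ⟯ := isCyclotomicExtension_adjoin_zeta hζ
  have : NumberField ℚ⟮ζ⟯ := IsCyclotomicExtension.numberField {p ^ (m + 1)} ℚ _
  have : IsGalois ℚ ℚ⟮ζ⟯ := IsCyclotomicExtension.isGalois {p ^ (m + 1)} ℚ _
  have : IsCyclic Gal(ℚ⟮ζ⟯/ℚ) := isCyclic_gal_of_isCyclotomicExtension hp hp2 (m + 1) _
  obtain ⟨F, hF⟩ := exists_finrank_eq_of_isCyclic (C := ℚ⟮ζ⟯) (d := p ^ m) <| by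
    rw [IsCyclotomicExtension.finrank (n := p ^ (m + 1)) ℚ⟮ζ⟯
      (Polynomial.cyclotomic.irreducible_rat (NeZero.pos _)), Nat.totient_prime_pow_succ hp]
    exact dvd_mul_right _ _
  let e : F ≃ₐ[ℚ] lift F := liftAlgEquiv F
  exact ⟨lift F, lift_le F, e.toLinearEquiv.finrank_eq.symm.trans hF⟩

theorem le_adjoin_zeta (hp : p.Prime) (hp2 : 2 < p) {K : IntermediateField ℚ Ω}
    [NumberField K] [IsGalois ℚ K] [IsCyclic Gal(K/ℚ)] (hdeg : Module.finrank ℚ K = p ^ m)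
    (hunr : UnramifiedOutside p K) {ζ : Ω} (hζ : IsPrimitiveRoot ζ (p ^ (m + 1))) : K ≤ ℚ⟮ζ⟯ := by
  obtain ⟨L, hL, hd⟩ := exists_le_adjoin_zeta hp hp2 hζ
  exact eq_of_le_adjoin_zeta hp hp2 hdeg hunr hζ hL hd ▸ hL

theorem UnramifiedOutside.isCyclotomic (hp : p.Prime) (hp2 : 2 < p) {K : Type*} [Field K]
    [NumberField K] [IsGalois ℚ K] [IsCyclic Gal(K/ℚ)] (hdeg : Module.finrank ℚ K = p ^ m)
    (hunr : UnramifiedOutside p K) : IsCyclotomic K := by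
  have : NeZero (p ^ (m + 1)) := ⟨pow_ne_zero _ hp.ne_zero⟩
  -- An abstract `K` is moved into an algebraically closed field, so that a suitable `ζ` exists
  -- beside it.
  let f : K →ₐ[ℚ] AlgebraicClosure K := (algebraMap K (AlgebraicClosure K)).toRatAlgHom
  let e : K ≃ₐ[ℚ] f.fieldRange := AlgEquiv.ofInjectiveField f
  obtain ⟨_, _, d, u⟩ := hunr.transfer e
  have : NumberField f.fieldRange :=
    { to_charZero := inferInstance
      to_finiteDimensional := e.toLinearEquiv.finiteDimensional }
  have : NeZero ((p ^ (m + 1) : ℕ) : AlgebraicClosure K) := NeZero.charZero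
  obtain ⟨ζ, hζ⟩ := HasEnoughRootsOfUnity.exists_primitiveRoot (AlgebraicClosure K) (p ^ (m + 1))
  have hle := le_adjoin_zeta hp hp2 (d.trans hdeg) u hζ
  have hC : IsCyclotomicExtension {p ^ (m + 1)} ℚ ℚ⟮ζ⟯ := isCyclotomicExtension_adjoin_zeta hζ
  let i : f.fieldRange →ₐ[ℚ] ℚ⟮ζ⟯ := inclusion hle
  have hC' : IsCyclotomicExtension {p ^ (m + 1)} ℚ (CyclotomicField (p ^ (m + 1)) ℚ) := by
    convert CyclotomicField.isCyclotomicExtension (p ^ (m + 1)) ℚ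
    · rfl
    · exact Subsingleton.elim (α := Algebra ℚ (CyclotomicField (p ^ (m + 1)) ℚ)) _ _
  let j : ℚ⟮ζ⟯ ≃ₐ[ℚ] CyclotomicField (p ^ (m + 1)) ℚ :=
    IsCyclotomicExtension.algEquiv {p ^ (m + 1)} ℚ _ _
  exact ⟨p ^ (m + 1), NeZero.pos _, ⟨(j.toAlgHom.comp i).comp e.toAlgHom⟩⟩

end Subfields

theorem mainTheorem3 {Ω : Type*} [Field Ω] [Algebra ℚ Ω] (p m : ℕ) (hp : p.Prime) (hodd : Odd p)
    (K : IntermediateField ℚ Ω) [IsGalois ℚ K] [IsCyclic Gal(K/ℚ)]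
    (hdeg : Module.finrank ℚ K = p ^ m) (hunr : UnramifiedOutside p K) :
    IsCyclotomic K ∧
      ∀ ζ : Ω, IsPrimitiveRoot ζ (p ^ (m + 1)) →
        K ≤ ℚ⟮ζ⟯ ∧
          ∀ L : IntermediateField ℚ Ω, L ≤ ℚ⟮ζ⟯ → Module.finrank ℚ L = p ^ m → K = L := by
  have : CharZero Ω := algebraRat.charZero Ω
  obtain rfl : ‹Algebra ℚ Ω› = DivisionRing.toRatAlgebra := Subsingleton.elim _ _
  have hp2 : 2 < p := by
    have := hp.two_le
    have : p ≠ 2 := by rintro rfl; exact absurd hodd (by decide)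
    omega
  have : NumberField K :=
    { to_charZero := inferInstance
      -- `finrank` is 0 in infinite dimension, so `hdeg` alone gives finiteness.
      to_finiteDimensional := Module.finite_of_finrank_pos (hdeg ▸ pow_pos hp.pos m) }
  exact ⟨hunr.isCyclotomic hp hp2 hdeg, fun ζ hζ => ⟨le_adjoin_zeta hp hp2 hdeg hunr hζ,
    fun L hL hLdeg => eq_of_le_adjoin_zeta hp hp2 hdeg hunr hζ hL hLdeg⟩⟩
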